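/- Conventions. For $A,B\subset\mathbf{R}_+=[0,\infty)$ write $A\preccurlyeq B$ if there is $c>0$ such that for every $a\in A$ the interval $[c^{-1}a,ca]$ contains an element of $B$; write $A\sim B$ if $A\preccurlyeq B$ and $B\preccurlyeq A$; write $[A]\subset[B]$ if there are $A'\sim A$ and $B'\sim B$ with $A'\subset B'$. Let $G$ be a (Hausdorff) locally compact group. For a compact generating subset $S$ of $G$, with free group $F_S$, let $\mathcal{R}_S(G)$ be the set of integers $n\ge 0$ such that the normal subgroup of $F_S$ generated by the elements of length at most $n$ of $N=\ker(F_S\to G)$ is strictly larger than the one generated by the elements of $N$ of length at most $n-1$. The group $G$ is compactly generated if it has a compact generating subset. If it is, $G$ is densely related if $\mathcal{R}_S(G)\sim\{1,2,3,\dots\}$ for some compact generating subset $S$, and lacunary presented otherwise. For a compact generating subset $T$, let $d_T$ be the word metric on $G$. Given an ultrafilter $\omega$ on $\mathbf{N}$ and positive real numbers $(s_n)$ with $\lim_\omega s_n=+\infty$ (a scaling sequence along $\omega$), the asymptotic cone $\mathrm{Cone}^\omega(G,(s_n))$ with respect to $T$ is the set of sequences $(g_n)$ in $G$ with $d_T(g_n,1)/s_n$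 bounded along $\omega$, modulo $\lim_\omega d_T(g_n,h_n)/s_n=0$, with the metric $\lim_\omega d_T(g_n,h_n)/s_n$. The group $G$ is lacunary hyperbolic if it is compactly generated and, for some $T$, $\omega$ and $(s_n)$, this cone is a real tree (a geodesic metric space in which $d(a,b)+d(c,d)\le\max\{d(a,c)+d(b,d),\,d(a,d)+d(b,c)\}$ for all points $a,b,c,d$). Statement. Let $G$ be a locally compact group. (1) Let $S,T$ be compact generating subsets of $G$, let $\omega$ be an ultrafilter on $\mathbf{N}$ and let $(s_n)$ be a scaling sequence along $\omega$. If $\mathrm{Cone}^\omega(G,(s_n))$ with respect to $T$ is simply connected, then $[\{s_n:n\in\mathbf{N}\}]\not\subset[\mathcal{R}_S(G)]$. (2) If $G$ is densely related (in particular compactly generated), then none of its asymptotic cones $\mathrm{Cone}^\omega(G,(s_n))$, with respect to any compact generating subset, is simply connected. (3) If $G$ is lacunary hyperbolic, then it is lacunary presented. -/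

import Mathlib

open Filter Topology
open scoped NNReal

namespace RelRange

/-! ### Subsets of `[0, ∞)` up to finite multiplicative Hausdorff distance -/

/-- `A ≼ B`: for some `c > 0`, every interval `[c⁻¹ a, c a]` with `a ∈ A` meets `B`. -/
def Dominated (A B : Set ℝ≥0) : Prop :=
  ∃ c : ℝ≥0, 0 < c ∧ ∀ a ∈ A, ∃ b ∈ B, c⁻¹ * a ≤ b ∧ b ≤ c * a

/-- `A ∼ B`: finite multiplicative Hausdorff distance. -/
def Equivalent (A B : Set ℝ≥0) : Prop :=
  Dominated A B ∧ Dominated B A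

/-- `[A] ⊂ [B]`: inclusion between the `∼`-classes of `A` and `B`. -/
def ClassSubset (A B : Set ℝ≥0) : Prop :=
  ∃ A' B' : Set ℝ≥0, Equivalent A' A ∧ Equivalent B' B ∧ A' ⊆ B'

/-- The positive integers, as a subset of `[0, ∞)`. -/
def positiveIntegers : Set ℝ≥0 :=
  {x | ∃ n : ℕ, 1 ≤ n ∧ (n : ℝ≥0) = x}

/-! ### The relation range of a group with respect to a generating subset -/

section Words

variable {G : Type*} [Group G]

open scoped Classical in
/-- Word length on the free group `F_S` (length of the reduced word). -/
noncomputable def freeLength {S : Set G} (w : FreeGroup S) : ℕ :=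
  w.norm

/-- The natural map `F_S → G`. -/
def evalHom (S : Set G) : FreeGroup S →* G :=
  FreeGroup.lift (fun s : S => (s : G))

/-- The normal subgroup of `F_S` generated by the relations of length `< n`. -/
noncomputable def shortRelations (S : Set G) (n : ℕ) : Subgroup (FreeGroup S) :=
  Subgroup.normalClosure {w | w ∈ (evalHom S).ker ∧ freeLength w < n}

/-- The relation range `R_S(G)`: the lengths `n` such that the relations of length at most `n`
generate, as a normal subgroup, strictly more than the relations of length at most `n - 1`. -/
noncomputable def relationRange (S : Set G) : Set ℕ :=
  {n | shortRelations S n < shortRelations S (n + 1)}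

/-- The relation range as a subset of `[0, ∞)`. -/
noncomputable def relationRangeNN (S : Set G) : Set ℝ≥0 :=
  (fun n : ℕ => (n : ℝ≥0)) '' relationRange S

/-- Word length of `g ∈ G` with respect to `S`. -/
noncomputable def wordLength (S : Set G) (g : G) : ℕ :=
  sInf {n | ∃ w : FreeGroup S, evalHom S w = g ∧ freeLength w = n}

theorem evalHom_surjective {S : Set G} (hS : Subgroup.closure S = ⊤) :
    Function.Surjective (evalHom S) := by
  rw [← MonoidHom.range_eq_top, evalHom, FreeGroup.range_lift_eq_closure, Subtype.range_coe]
  exact hS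

theorem exists_word {S : Set G} (hS : Subgroup.closure S = ⊤) (g : G) :
    ∃ w : FreeGroup S, evalHom S w = g ∧ freeLength w = wordLength S g := by
  have hne : {n | ∃ w : FreeGroup S, evalHom S w = g ∧ freeLength w = n}.Nonempty := by
    obtain ⟨w, hw⟩ := evalHom_surjective hS g
    exact ⟨_, w, hw, rfl⟩
  exact Nat.sInf_mem hne

theorem wordLength_le {S : Set G} (w : FreeGroup S) :
    wordLength S (evalHom S w) ≤ freeLength w :=
  Nat.sInf_le ⟨w, rfl, rfl⟩

theorem wordLength_one (S : Set G) : wordLength S (1 : G) = 0 := by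
  classical
  have h := wordLength_le (1 : FreeGroup S)
  rw [map_one] at h
  simpa [freeLength] using h

theorem wordLength_inv_le {S : Set G} (hS : Subgroup.closure S = ⊤) (g : G) :
    wordLength S g⁻¹ ≤ wordLength S g := by
  classical
  obtain ⟨w, hw, hl⟩ := exists_word hS g
  have h := wordLength_le w⁻¹
  rw [map_inv, hw] at h
  rw [← hl]
  simpa [freeLength] using h

theorem wordLength_mul_le {S : Set G} (hS : Subgroup.closure S = ⊤) (g h : G) :
    wordLength S (g * h) ≤ wordLength S g + wordLength S h := by
  classical
  obtain ⟨v, hv, hlv⟩ := exists_word hS g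
  obtain ⟨w, hw, hlw⟩ := exists_word hS h
  have key := wordLength_le (v * w)
  rw [map_mul, hv, hw] at key
  rw [← hlv, ← hlw]
  exact key.trans (FreeGroup.norm_mul_le v w)

theorem eq_one_of_wordLength {S : Set G} (hS : Subgroup.closure S = ⊤) {g : G}
    (hg : wordLength S g = 0) : g = 1 := by
  classical
  obtain ⟨w, hw, hl⟩ := exists_word hS g
  rw [hg] at hl
  rw [← hw, FreeGroup.norm_eq_zero.mp hl, map_one]

end Words

/-! ### Compact generating subsets and word metrics -/

/-- A compact generating subset of a topological group. -/
structure CompactGenSet (G : Type*) [Group G] [TopologicalSpace G] where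
  carrier : Set G
  isCompact : IsCompact carrier
  closure_eq_top : Subgroup.closure carrier = ⊤

/-- The set `G`, to be equipped with the word metric associated with `S`. -/
def WordSpace {G : Type*} [Group G] [TopologicalSpace G] (_S : CompactGenSet G) : Type _ :=
  G

/-- The word metric `d_S(g, h) = |g⁻¹ h|_S`. -/
noncomputable instance {G : Type*} [Group G] [TopologicalSpace G] (S : CompactGenSet G) :
    MetricSpace (WordSpace S) where
  dist g h := (wordLength S.carrier ((show G from g)⁻¹ * (show G from h)) : ℝ)
  dist_self g := by
    have key : ∀ a : G, wordLength S.carrier (a⁻¹ * a) = 0 := by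
      intro a
      rw [inv_mul_cancel, wordLength_one]
    exact_mod_cast key g
  dist_comm g h := by
    have key : ∀ a b : G, wordLength S.carrier (a⁻¹ * b) ≤ wordLength S.carrier (b⁻¹ * a) := by
      intro a b
      have := wordLength_inv_le S.closure_eq_top (b⁻¹ * a)
      simpa using this
    exact_mod_cast le_antisymm (key g h) (key h g)
  dist_triangle g h k := by
    have key : ∀ a b c : G, wordLength S.carrier (a⁻¹ * c) ≤
        wordLength S.carrier (a⁻¹ * b) + wordLength S.carrier (b⁻¹ * c) := by
      intro a b c
      have := wordLength_mul_le S.closure_eq_top (a⁻¹ * b) (b⁻¹ * c)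
      simpa [mul_assoc] using this
    exact_mod_cast key g h k
  eq_of_dist_eq_zero := by
    intro g h hgh
    have key : ∀ a b : G, wordLength S.carrier (a⁻¹ * b) = 0 → a = b := by
      intro a b hab
      have := eq_one_of_wordLength S.closure_eq_top hab
      exact inv_mul_eq_one.mp this
    exact key g h (by exact_mod_cast hgh)

/-! ### Asymptotic cones -/

section Cone

variable {X : Type*} [PseudoMetricSpace X]

/-- Sequences `u` in `X` such that `d(uₙ, xₙ) / sₙ` is bounded along `ω`. -/
def ConeSequence (x : ℕ → X) (s : ℕ → ℝ≥0) (ω : Ultrafilter ℕ) : Type _ :=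
  {u : ℕ → X // ∃ C : ℝ, ∀ᶠ n in (ω : Filter ℕ), dist (u n) (x n) / (s n : ℝ) ≤ C}

variable {x : ℕ → X} {s : ℕ → ℝ≥0} {ω : Ultrafilter ℕ}

/-- The limit along `ω` of `d(uₙ, vₙ) / sₙ`. -/
noncomputable def coneDist (u v : ConeSequence x s ω) : ℝ :=
  limUnder (ω : Filter ℕ) (fun n => dist (u.1 n) (v.1 n) / (s n : ℝ))

theorem tendsto_coneDist (u v : ConeSequence x s ω) :
    Tendsto (fun n => dist (u.1 n) (v.1 n) / (s n : ℝ)) ω (𝓝 (coneDist u v)) := by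
  obtain ⟨C, hC⟩ := u.2
  obtain ⟨D, hD⟩ := v.2
  refine tendsto_nhds_limUnder ?_
  have hmem : ∀ᶠ n in (ω : Filter ℕ),
      dist (u.1 n) (v.1 n) / (s n : ℝ) ∈ Set.Icc (0 : ℝ) (C + D) := by
    filter_upwards [hC, hD] with n h1 h2
    refine ⟨by positivity, ?_⟩
    have h3 := dist_triangle_right (u.1 n) (v.1 n) (x n)
    calc dist (u.1 n) (v.1 n) / (s n : ℝ)
        ≤ (dist (u.1 n) (x n) + dist (v.1 n) (x n)) / (s n : ℝ) := by gcongr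
      _ = dist (u.1 n) (x n) / (s n : ℝ) + dist (v.1 n) (x n) / (s n : ℝ) := add_div _ _ _
      _ ≤ C + D := add_le_add h1 h2
  have hle : ((ω.map fun n => dist (u.1 n) (v.1 n) / (s n : ℝ) : Ultrafilter ℝ) : Filter ℝ) ≤
      𝓟 (Set.Icc (0 : ℝ) (C + D)) := by
    rw [le_principal_iff]
    exact hmem
  obtain ⟨l, -, hl⟩ := (isCompact_Icc (a := (0 : ℝ)) (b := C + D)).ultrafilter_le_nhds _ hle
  exact ⟨l, hl⟩

noncomputable instance : PseudoMetricSpace (ConeSequence x s ω) where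
  dist := coneDist
  dist_self u := by
    refine tendsto_nhds_unique (tendsto_coneDist u u) ?_
    simp
  dist_comm u v := by
    refine tendsto_nhds_unique (tendsto_coneDist u v) ?_
    simpa only [dist_comm] using tendsto_coneDist v u
  dist_triangle u v w := by
    refine le_of_tendsto_of_tendsto' (tendsto_coneDist u w)
      ((tendsto_coneDist u v).add (tendsto_coneDist v w)) (fun n => ?_)
    rw [← add_div]
    have := dist_triangle (u.1 n) (v.1 n) (w.1 n)
    gcongr

variable (x s ω) in
/-- The asymptotic cone `Cone^ω(X, (xₙ), (sₙ))`: two sequences are identified when their distance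
`lim_ω d(uₙ, vₙ) / sₙ` vanishes. -/
abbrev AsymptoticCone : Type _ :=
  SeparationQuotient (ConeSequence x s ω)

end Cone

section Group

variable {G : Type*} [Group G] [TopologicalSpace G]

/-- The asymptotic cone `Cone^ω(G, (sₙ))` of `G` for the word metric `d_S`, based at `1`. -/
abbrev GroupCone (S : CompactGenSet G) (s : ℕ → ℝ≥0) (ω : Ultrafilter ℕ) : Type _ :=
  AsymptoticCone (X := WordSpace S) (fun _ => (1 : G)) s ω

/-- A scaling sequence along `ω`: positive numbers tending to `+∞` along `ω`. -/
def IsScaling (s : ℕ → ℝ≥0) (ω : Ultrafilter ℕ) : Prop :=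
  (∀ n, 0 < s n) ∧ Tendsto s (ω : Filter ℕ) atTop

/-- A real tree: a geodesic metric space satisfying the `0`-hyperbolic four-point inequality. -/
def IsRealTree (T : Type*) [MetricSpace T] : Prop :=
  (∀ a b : T, ∃ γ : ℝ → T, γ 0 = a ∧ γ (dist a b) = b ∧
    ∀ t ∈ Set.Icc 0 (dist a b), ∀ t' ∈ Set.Icc 0 (dist a b), dist (γ t) (γ t') = |t - t'|) ∧
  ∀ a b c d : T,
    dist a b + dist c d ≤ max (dist a c + dist b d) (dist a d + dist b c)

variable (G)

/-- `G` is compactly generated and its relation range, with respect to a compact generating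
subset, is at finite multiplicative Hausdorff distance from the positive integers. -/
def DenselyRelated : Prop :=
  ∃ S : CompactGenSet G, Equivalent (relationRangeNN S.carrier) positiveIntegers

/-- `G` is compactly generated and not densely related. -/
def LacunaryPresented : Prop :=
  Nonempty (CompactGenSet G) ∧ ¬ DenselyRelated G

/-- `G` is compactly generated and at least one of its asymptotic cones is a real tree. -/
def LacunaryHyperbolic : Prop :=
  ∃ (S : CompactGenSet G) (s : ℕ → ℝ≥0) (ω : Ultrafilter ℕ),
    IsScaling s ω ∧ IsRealTree (GroupCone S s ω)

end Group

end RelRange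

/-! An element `r` of the relation range is the length of a relation not generated by shorter ones.
If such lengths `r_n` are comparable to `s_n` for `ω`-most `n`, the loops of the corresponding
relations `w_n`, rescaled by `s_n`, converge to a Lipschitz loop in the cone (`exists_limit_loop`).
A null-homotopy of this loop is uniformly continuous, so on a fine `K × K` grid its neighbouring
values are close. Represented by sequences in `G`, these values give, for some `n`, a grid filling
of `w_n` whose edges have length at most `r_n / 8`. Each square is then a relation of length at most
`r_n / 2`, so `w_n` follows from shorter relations (`mem_shortRelations_of_grid`), a contradiction.
This proves (1). The generating sets `S` and `T` may differ because their word metrics are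
bi-Lipschitz equivalent, by Baire.

For (2), the positive integers are within a factor 2 of every real number at least 1, so the
comparison holds for every scaling sequence. For (3), a real tree is contractible, hence simply
connected, so (2) applies. -/

namespace RelRange

/-! ### Comparison of word metrics -/

section WordMetrics

variable {G : Type*} [Group G]

theorem wordLength_le_one_of_mem {S : Set G} {g : G} (hg : g ∈ S) : wordLength S g ≤ 1 := by
  classical
  have h := wordLength_le (FreeGroup.of (⟨g, hg⟩ : S))
  have h1 : evalHom S (FreeGroup.of (⟨g, hg⟩ : S)) = g := by simp [evalHom]
  have h2 : freeLength (FreeGroup.of (⟨g, hg⟩ : S)) = 1 := FreeGroup.norm_of _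
  rwa [h1, h2] at h

open scoped Pointwise in
theorem wordLength_le_of_mem_pow {S : Set G} (hS : Subgroup.closure S = ⊤) (n : ℕ) {g : G}
    (hg : g ∈ (S ∪ S⁻¹ ∪ {1}) ^ n) : wordLength S g ≤ n := by
  induction n generalizing g with
  | zero =>
    rw [pow_zero, Set.mem_one] at hg
    rw [hg, wordLength_one]
  | succ n ih =>
    rw [pow_succ, Set.mem_mul] at hg
    obtain ⟨a, ha, b, hb, rfl⟩ := hg
    refine (wordLength_mul_le hS a b).trans (add_le_add (ih ha) ?_)
    rcases hb with (hb | hb) | hb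
    · exact wordLength_le_one_of_mem hb
    · have := wordLength_inv_le hS b⁻¹
      rw [inv_inv] at this
      exact this.trans (wordLength_le_one_of_mem hb)
    · rw [Set.mem_singleton_iff.mp hb, wordLength_one]
      exact zero_le_one

open scoped Pointwise in
theorem exists_mem_pow {S : Set G} (hS : Subgroup.closure S = ⊤) (g : G) :
    ∃ n : ℕ, g ∈ (S ∪ S⁻¹ ∪ {1}) ^ n := by
  have hsymm : (S ∪ S⁻¹ ∪ {1})⁻¹ = S ∪ S⁻¹ ∪ {1} := by
    rw [Set.union_inv, Set.union_inv, inv_inv, Set.inv_singleton, inv_one, Set.union_comm S⁻¹]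
  have hg : g ∈ Subgroup.closure S := hS ▸ Subgroup.mem_top g
  induction hg using Subgroup.closure_induction with
  | mem x hx => exact ⟨1, by rw [pow_one]; exact Or.inl (Or.inl hx)⟩
  | one => exact ⟨0, by simp⟩
  | mul x y _ _ hx hy =>
    obtain ⟨m, hm⟩ := hx
    obtain ⟨n, hn⟩ := hy
    exact ⟨m + n, by rw [pow_add]; exact Set.mul_mem_mul hm hn⟩
  | inv x _ hx =>
    obtain ⟨n, hn⟩ := hx
    exact ⟨n, by rw [← hsymm, inv_pow, Set.inv_mem_inv]; exact hn⟩

theorem wordLength_le_mul_wordLength {S T : Set G} (hS : Subgroup.closure S = ⊤)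
    (hT : Subgroup.closure T = ⊤) {L : ℕ} (hL : ∀ t ∈ T, wordLength S t ≤ L) (g : G) :
    wordLength S g ≤ L * wordLength T g := by
  classical
  obtain ⟨w, hw, hl⟩ := exists_word hT g
  have key : ∀ l : List (T × Bool),
      wordLength S (evalHom T (FreeGroup.mk l)) ≤ L * l.length := by
    intro l
    induction l with
    | nil =>
      have : (FreeGroup.mk [] : FreeGroup T) = 1 := rfl
      rw [this, map_one, wordLength_one]
      exact Nat.zero_le _
    | cons a l ih =>
      have ha : wordLength S (evalHom T (FreeGroup.mk [a])) ≤ L := by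
        obtain ⟨t, b⟩ := a
        cases b
        · have h1 : evalHom T (FreeGroup.mk [(t, false)]) = (t : G)⁻¹ := by
            simp [evalHom]
          rw [h1]
          exact (wordLength_inv_le hS _).trans (hL t t.2)
        · have h1 : evalHom T (FreeGroup.mk [(t, true)]) = (t : G) := by
            simp [evalHom]
          rw [h1]
          exact hL t t.2
      have h2 : (FreeGroup.mk (a :: l) : FreeGroup T) = FreeGroup.mk [a] * FreeGroup.mk l := by
        rw [FreeGroup.mul_mk, List.singleton_append]
      rw [h2, map_mul, List.length_cons, mul_add, mul_one, add_comm (L * _)]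
      exact (wordLength_mul_le hS _ _).trans (add_le_add ha ih)
  have h := key w.toWord
  rw [FreeGroup.mk_toWord, hw] at h
  rw [← hl]
  exact h

/-- By Baire's theorem, word metrics of compact generating subsets are comparable. -/
theorem exists_wordLength_le_mul [TopologicalSpace G] [IsTopologicalGroup G]
    [LocallyCompactSpace G] [T2Space G] (S T : CompactGenSet G) :
    ∃ L : ℕ, ∀ g : G, wordLength S.carrier g ≤ L * wordLength T.carrier g := by
  open scoped Pointwise in
  have hB : ∀ n : ℕ, IsCompact ((S.carrier ∪ S.carrier⁻¹ ∪ {1}) ^ n) := by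
    intro n
    induction n with
    | zero => rw [pow_zero]; exact isCompact_singleton
    | succ n ih =>
      rw [pow_succ]
      exact ih.mul ((S.isCompact.union S.isCompact.inv).union isCompact_singleton)
  -- The compact, hence closed, powers exhaust `G`; by Baire one of them has an interior point `g₀`,
  -- near which the `S`-length is at most `n`.
  obtain ⟨n, g₀, hg₀⟩ := nonempty_interior_of_iUnion_of_closed (fun n => (hB n).isClosed)
    (Set.eq_univ_of_forall fun g => Set.mem_iUnion.mpr (exists_mem_pow S.closure_eq_top g))
  have hnhds : {g | wordLength S.carrier g ≤ n} ∈ 𝓝 g₀ :=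
    mem_of_superset (mem_interior_iff_mem_nhds.mp hg₀)
      fun g hg => wordLength_le_of_mem_pow S.closure_eq_top n hg
  have hn₀ : wordLength S.carrier g₀ ≤ n :=
    mem_of_mem_nhds (s := {g | wordLength S.carrier g ≤ n}) hnhds
  obtain ⟨F, -, hF⟩ := T.isCompact.elim_nhds_subcover
    (fun x => {y | wordLength S.carrier (g₀ * x⁻¹ * y) ≤ n}) (fun x _ => by
      have hc : ContinuousAt (fun y => g₀ * x⁻¹ * y) x := by fun_prop
      have hx : g₀ * x⁻¹ * x = g₀ := by group
      exact hc.preimage_mem_nhds (t := {g | wordLength S.carrier g ≤ n}) (hx.symm ▸ hnhds))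
  -- Write `t = x · g₀⁻¹ · (g₀ x⁻¹ t)` with `x ∈ F`: the last two factors have length at most `n`
  -- each.
  refine ⟨F.sup (wordLength S.carrier) + 2 * n,
    wordLength_le_mul_wordLength S.closure_eq_top T.closure_eq_top fun t ht => ?_⟩
  obtain ⟨x, hx, hxt⟩ := Set.mem_iUnion₂.mp (hF ht)
  have h1 : wordLength S.carrier x ≤ F.sup (wordLength S.carrier) := Finset.le_sup hx
  have h2 := wordLength_inv_le S.closure_eq_top g₀
  have h3 := wordLength_mul_le S.closure_eq_top (x * g₀⁻¹) (g₀ * x⁻¹ * t)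
  have h4 := wordLength_mul_le S.closure_eq_top x g₀⁻¹
  have h5 : x * g₀⁻¹ * (g₀ * x⁻¹ * t) = t := by group
  rw [h5] at h3
  have h6 : wordLength S.carrier (g₀ * x⁻¹ * t) ≤ n := hxt
  omega

end WordMetrics

/-! ### Grids of short relations -/

section Grid

/-- In a grid of commuting squares in a group, the bottom and top rows are related by the sides. -/
theorem prod_row_mul_eq {Q : Type*} [Group Q] {h v : ℕ → ℕ → Q} {K : ℕ} {j : ℕ}
    (hsq : ∀ i < K, h i j * v (i + 1) j = v i j * h i (j + 1)) {k : ℕ} (hk : k ≤ K) :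
    ((List.range k).map fun i => h i j).prod * v k j =
      v 0 j * ((List.range k).map fun i => h i (j + 1)).prod := by
  induction k with
  | zero => simp
  | succ k ih =>
    rw [List.range_succ]
    simp only [List.map_append, List.prod_append, List.map_cons, List.map_nil, List.prod_cons,
      List.prod_nil, mul_one]
    rw [mul_assoc, hsq k (by omega), ← mul_assoc, ih (by omega), mul_assoc]

variable {G : Type*} [Group G] {S : Set G}

instance (r : ℕ) : (shortRelations S r).Normal := Subgroup.normalClosure_normal

/-- The word `u⁻¹ v` is itself a relation of length less than `r`. -/
theorem mk_eq_mk_of_evalHom_eq {r : ℕ} {u v : FreeGroup S} (h : evalHom S u = evalHom S v)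
    (hl : freeLength u + freeLength v < r) :
    (u : FreeGroup S ⧸ shortRelations S r) = v := by
  classical
  refine QuotientGroup.eq.mpr (Subgroup.subset_normalClosure ⟨?_, ?_⟩)
  · rw [MonoidHom.mem_ker, map_mul, map_inv, h, inv_mul_cancel]
  · refine lt_of_le_of_lt (FreeGroup.norm_mul_le _ _) ?_
    rw [FreeGroup.norm_inv_eq]
    exact hl

theorem prod_map_inv_mul {H : Type*} [Group H] (p : ℕ → H) (k : ℕ) :
    ((List.range k).map fun i => (p i)⁻¹ * p (i + 1)).prod = (p 0)⁻¹ * p k := by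
  induction k with
  | zero => simp
  | succ k ih =>
    rw [List.range_succ]
    simp [ih]

/-- A word bounding a square grid in `G` with edges of length `≤ δ` is a consequence of relations
of length `≤ 4δ`. -/
theorem mem_shortRelations_of_grid (hS : Subgroup.closure S = ⊤) {r δ K : ℕ} (hδ : 4 * δ < r)
    (f : ℕ → ℕ → G) (p : ℕ → FreeGroup S) (hp0 : p 0 = 1)
    (hpf : ∀ i ≤ K, f i 0 = evalHom S (p i))
    (hpl : ∀ i < K, freeLength ((p i)⁻¹ * p (i + 1)) ≤ δ)
    (hh : ∀ i < K, ∀ j ≤ K, wordLength S ((f i j)⁻¹ * f (i + 1) j) ≤ δ)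
    (hv : ∀ i ≤ K, ∀ j < K, wordLength S ((f i j)⁻¹ * f i (j + 1)) ≤ δ)
    (hleft : ∀ j ≤ K, f 0 j = 1) (hright : ∀ j ≤ K, f K j = 1) (htop : ∀ i ≤ K, f i K = 1) :
    p K ∈ shortRelations S r := by
  classical
  choose word hword hlen using fun g : G => exists_word hS g
  -- `φ` need not be a homomorphism, but it respects small commuting squares: their perimeter is at
  -- most `4δ < r`.
  let φ : G → FreeGroup S ⧸ shortRelations S r := fun g => (word g : FreeGroup S)
  have hφ1 : φ 1 = 1 := by
    have h1 : word 1 = 1 := by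
      have := hlen 1
      rw [wordLength_one] at this
      exact FreeGroup.norm_eq_zero.mp this
    simp only [φ, h1, QuotientGroup.mk_one]
  have hφmul : ∀ a b c d : G, a * b = c * d → wordLength S a ≤ δ → wordLength S b ≤ δ →
      wordLength S c ≤ δ → wordLength S d ≤ δ → φ a * φ b = φ c * φ d := by
    intro a b c d he ha hb hc hd
    simp only [φ, ← QuotientGroup.mk_mul]
    refine mk_eq_mk_of_evalHom_eq (by simp [map_mul, hword, he]) ?_
    have h1 : freeLength (word a * word b) ≤ freeLength (word a) + freeLength (word b) :=
      FreeGroup.norm_mul_le _ _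
    have h2 : freeLength (word c * word d) ≤ freeLength (word c) + freeLength (word d) :=
      FreeGroup.norm_mul_le _ _
    simp only [hlen] at h1 h2
    omega
  let h : ℕ → ℕ → FreeGroup S ⧸ shortRelations S r := fun i j => φ ((f i j)⁻¹ * f (i + 1) j)
  let v : ℕ → ℕ → FreeGroup S ⧸ shortRelations S r := fun i j => φ ((f i j)⁻¹ * f i (j + 1))
  have hrow : ∀ j ≤ K, ((List.range K).map fun i => h i 0).prod =
      ((List.range K).map fun i => h i j).prod := by
    intro j
    induction j with
    | zero => intro _; rfl
    | succ j ih =>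
      intro hj
      have key := prod_row_mul_eq (h := h) (v := v) (K := K) (j := j) (fun i hi =>
        hφmul _ _ _ _ (by group) (hh i hi j (by omega)) (hv (i + 1) (by omega) j (by omega))
          (hv i (by omega) j (by omega)) (hh i hi (j + 1) hj)) le_rfl
      have h0 : v 0 j = 1 := by
        simp only [v, hleft j (by omega), hleft (j + 1) hj, inv_one, mul_one, hφ1]
      have hK : v K j = 1 := by
        simp only [v, hright j (by omega), hright (j + 1) hj, inv_one, mul_one, hφ1]
      rw [h0, hK, one_mul, mul_one] at key
      rw [ih (by omega), key]
  have hbot : ((List.range K).map fun i => h i 0).prod =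
      (p K : FreeGroup S ⧸ shortRelations S r) := by
    -- Replacing a step of `p` by a shortest word with the same value costs a relation of length at
    -- most `2δ`.
    have h1 : ((List.range K).map fun i => h i 0) = (List.range K).map
        fun i => (p i : FreeGroup S ⧸ shortRelations S r)⁻¹ * p (i + 1) := by
      refine List.map_congr_left fun i hi => ?_
      have hi' : i < K := List.mem_range.mp hi
      refine mk_eq_mk_of_evalHom_eq ?_ ?_
      · rw [hword, hpf i hi'.le, hpf (i + 1) hi', map_mul, map_inv]
      · have a1 := hpl i hi'
        have a2 := hh i hi' 0 (Nat.zero_le _)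
        rw [hlen]
        exact lt_of_le_of_lt (add_le_add a2 a1) (by omega)
    rw [h1, prod_map_inv_mul fun i => (p i : FreeGroup S ⧸ shortRelations S r), hp0]
    simp
  have htop' : ((List.range K).map fun i => h i K).prod = 1 := by
    refine List.prod_eq_one fun x hx => ?_
    obtain ⟨i, hi, rfl⟩ := List.mem_map.mp hx
    have hi' : i < K := List.mem_range.mp hi
    simp only [h, htop i hi'.le, htop (i + 1) hi', inv_one, mul_one, hφ1]
  rw [← QuotientGroup.eq_one_iff, ← hbot, hrow K le_rfl, htop']

end Grid

/-! ### Real trees are contractible -/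

/-- Contract along geodesics to a point `p`. The four-point inequality makes these geodesics depend
continuously on their endpoint. -/
theorem IsRealTree.contractibleSpace {X : Type*} [MetricSpace X] [Nonempty X]
    (hX : IsRealTree X) : ContractibleSpace X := by
  obtain ⟨hgeo, hhyp⟩ := hX
  obtain ⟨p⟩ := ‹Nonempty X›
  choose γ hγ0 hγ1 hγ using fun x => hgeo p x
  have hpγ : ∀ x, ∀ a ∈ Set.Icc 0 (dist p x), dist p (γ x a) = a := by
    intro x a ha
    have := hγ x 0 ⟨le_rfl, dist_nonneg⟩ a ha
    rwa [hγ0, zero_sub, abs_neg, abs_of_nonneg ha.1] at this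
  have hγx : ∀ x, ∀ a ∈ Set.Icc 0 (dist p x), dist (γ x a) x = dist p x - a := by
    intro x a ha
    have := hγ x a ha (dist p x) ⟨dist_nonneg, le_rfl⟩
    rwa [hγ1, abs_sub_comm, abs_of_nonneg (sub_nonneg.mpr ha.2)] at this
  have key : ∀ x y, ∀ a ∈ Set.Icc 0 (dist p x), ∀ b ∈ Set.Icc 0 (dist p y),
      dist (γ x a) (γ y b) ≤ max |a - b| (dist x y) := by
    -- The four-point inequality for `γ y b, x, p, y` bounds `dist (γ y b) x`; inserting this in the
    -- one for `γ x a, γ y b, p, x` gives the claim.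
    intro x y a ha b hb
    have h1 := hhyp (γ x a) (γ y b) p x
    have h2 := hhyp (γ y b) x p y
    have e1 := hpγ x a ha
    have e2 := hpγ y b hb
    have e3 := hγx x a ha
    have e4 := hγx y b hb
    rw [dist_comm p] at e1 e2
    rw [e1, e3] at h1
    rw [e2, e4, dist_comm x p] at h2
    have a1 := ha.2
    have b1 := hb.2
    have l1 := le_abs_self (a - b)
    have l2 := neg_le_abs (a - b)
    have m1 := le_max_left |a - b| (dist x y)
    have m2 := le_max_right |a - b| (dist x y)
    rcases le_max_iff.mp h1 with h1 | h1 <;> rcases le_max_iff.mp h2 with h2 | h2 <;> linarith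
  have hmem : ∀ (t : unitInterval) (x : X), (t : ℝ) * dist p x ∈ Set.Icc 0 (dist p x) :=
    fun t x => ⟨mul_nonneg t.2.1 dist_nonneg, mul_le_of_le_one_left dist_nonneg t.2.2⟩
  have hcont : Continuous fun z : unitInterval × X => γ z.2 ((z.1 : ℝ) * dist p z.2) := by
    rw [continuous_iff_continuousAt]
    rintro ⟨t, x⟩
    rw [ContinuousAt, tendsto_iff_dist_tendsto_zero]
    have hlim : Tendsto (fun z : unitInterval × X =>
        max |(z.1 : ℝ) * dist p z.2 - (t : ℝ) * dist p x| (dist z.2 x)) (𝓝 (t, x)) (𝓝 0) := by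
      have hc : Continuous fun z : unitInterval × X =>
          max |(z.1 : ℝ) * dist p z.2 - (t : ℝ) * dist p x| (dist z.2 x) := by fun_prop
      simpa using hc.tendsto (t, x)
    exact squeeze_zero (fun _ => dist_nonneg) (fun z => key _ _ _ (hmem _ _) _ (hmem _ _)) hlim
  rw [contractible_iff_id_nullhomotopic]
  refine ⟨p, ContinuousMap.Homotopic.symm ⟨⟨⟨_, hcont⟩, fun x => ?_, fun x => ?_⟩⟩⟩
  · simp [hγ0]
  · simp [hγ1]

/-! ### Loops in asymptotic cones defined by relations -/

section Prefix

variable {G : Type*} {S : Set G}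

open scoped Classical in
/-- The prefix of the reduced word `w` of length `⌊t |w|⌋`. -/
noncomputable def prefixWord (w : FreeGroup S) (t : ℝ) : FreeGroup S :=
  FreeGroup.mk (w.toWord.take ⌊t * freeLength w⌋₊)

theorem prefixWord_zero (w : FreeGroup S) : prefixWord w 0 = 1 := by
  simp [prefixWord, FreeGroup.one_eq_mk]

theorem prefixWord_one (w : FreeGroup S) : prefixWord w 1 = w := by
  classical
  have h : (w.toWord.take (freeLength w)) = w.toWord := List.take_length
  simp only [prefixWord, one_mul, Nat.floor_natCast]
  rw [h, FreeGroup.mk_toWord]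

/-- The `+ 1` is the rounding error of the floors; it vanishes after division by `s n`. -/
theorem freeLength_prefixWord_inv_mul (w : FreeGroup S) {t t' : ℝ} (ht : 0 ≤ t) (h : t ≤ t') :
    (freeLength ((prefixWord w t)⁻¹ * prefixWord w t') : ℝ) ≤ (t' - t) * freeLength w + 1 := by
  classical
  have hkm : ⌊t * freeLength w⌋₊ ≤ ⌊t' * freeLength w⌋₊ := by gcongr
  have hsplit : prefixWord w t' = prefixWord w t *
      FreeGroup.mk ((w.toWord.take ⌊t' * freeLength w⌋₊).drop ⌊t * freeLength w⌋₊) := by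
    rw [prefixWord, prefixWord, FreeGroup.mul_mk]
    congr 1
    conv_lhs => rw [← List.take_append_drop ⌊t * freeLength w⌋₊
      (w.toWord.take ⌊t' * freeLength w⌋₊), List.take_take, min_eq_left hkm]
  have hlen : freeLength ((prefixWord w t)⁻¹ * prefixWord w t') ≤
      ⌊t' * freeLength w⌋₊ - ⌊t * freeLength w⌋₊ := by
    rw [hsplit, inv_mul_cancel_left]
    refine FreeGroup.norm_mk_le.trans ?_
    rw [List.length_drop, List.length_take]
    omega
  have h1 : (freeLength ((prefixWord w t)⁻¹ * prefixWord w t') : ℝ) ≤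
      (⌊t' * freeLength w⌋₊ : ℝ) - ⌊t * freeLength w⌋₊ := by
    rw [← Nat.cast_sub hkm]
    exact_mod_cast hlen
  have h2 : (⌊t' * freeLength w⌋₊ : ℝ) ≤ t' * freeLength w :=
    Nat.floor_le (mul_nonneg (ht.trans h) (Nat.cast_nonneg _))
  have h3 := Nat.lt_floor_add_one (t * freeLength w)
  linarith

end Prefix

/-- Otherwise every relation of length exactly `r` follows from shorter ones, and the normal closure
does not grow at `r`. -/
theorem exists_relation_of_mem_relationRange {G : Type*} [Group G] {S : Set G} {r : ℕ}
    (hr : r ∈ relationRange S) :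
    ∃ w ∈ (evalHom S).ker, freeLength w = r ∧ w ∉ shortRelations S r := by
  by_contra! hcon
  refine absurd hr (not_lt_of_ge (Subgroup.normalClosure_le_normal fun w hw => ?_))
  rcases Nat.lt_succ_iff_lt_or_eq.mp hw.2 with h | h
  · exact Subgroup.subset_normalClosure ⟨hw.1, h⟩
  · exact hcon w hw.1 h

theorem eventually_dist_lt_of_dist_mk_lt {X : Type*} [PseudoMetricSpace X] {x : ℕ → X}
    {s : ℕ → ℝ≥0} {ω : Ultrafilter ℕ} (hs : ∀ n, 0 < s n) {u v : ConeSequence x s ω} {ε : ℝ}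
    (h : dist (SeparationQuotient.mk u) (SeparationQuotient.mk v) < ε) :
    ∀ᶠ n in (ω : Filter ℕ), dist (u.1 n) (v.1 n) < ε * s n := by
  rw [SeparationQuotient.dist_mk] at h
  filter_upwards [(tendsto_coneDist u v).eventually_lt_const h] with n hn
  exact (div_lt_iff₀ (NNReal.coe_pos.mpr (hs n))).mp hn

section Loop

/-- An element of `G`, seen as a point of `G` with the word metric. -/
def toWordSpace {G : Type*} [Group G] [TopologicalSpace G] (T : CompactGenSet G) (g : G) :
    WordSpace T :=
  g

theorem dist_toWordSpace {G : Type*} [Group G] [TopologicalSpace G] (T : CompactGenSet G)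
    (g h : G) : dist (toWordSpace T g) (toWordSpace T h) = wordLength T.carrier (g⁻¹ * h) :=
  rfl

/-- The constant sequence at `1`. -/
def oneSeq {G : Type*} [Group G] [TopologicalSpace G] (T : CompactGenSet G) : ℕ → WordSpace T :=
  fun _ => toWordSpace T 1

/-- The base point of the asymptotic cone, as a sequence. -/
def baseSequence {G : Type*} [Group G] [TopologicalSpace G] (T : CompactGenSet G)
    (s : ℕ → ℝ≥0) (ω : Ultrafilter ℕ) : ConeSequence (oneSeq T) s ω :=
  ⟨oneSeq T, 0, Eventually.of_forall fun n => by rw [dist_self, zero_div]⟩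

variable {G : Type*} [Group G] [TopologicalSpace G] [IsTopologicalGroup G]
  [LocallyCompactSpace G] [T2Space G]

/-- If relations `wₙ` of length comparable to `sₙ` are given, then the loops they define in the
Cayley graph converge to a loop in the asymptotic cone. -/
theorem exists_limit_loop (S T : CompactGenSet G) {s : ℕ → ℝ≥0} {ω : Ultrafilter ℕ}
    (hs : IsScaling s ω) {c : ℝ} (w : ℕ → FreeGroup S.carrier)
    (hw : ∀ᶠ n in (ω : Filter ℕ), (freeLength (w n) : ℝ) ≤ c * s n) :
    ∃ u : unitInterval → ConeSequence (oneSeq T) s ω,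
      (∀ t n, (u t).1 n = toWordSpace T (evalHom S.carrier (prefixWord (w n) t))) ∧
      Continuous fun t => (SeparationQuotient.mk (u t) : AsymptoticCone (oneSeq T) s ω) := by
  obtain ⟨L, hL⟩ := exists_wordLength_le_mul T S
  have hd : ∀ n (t t' : unitInterval),
      dist (toWordSpace T (evalHom S.carrier (prefixWord (w n) t)))
        (toWordSpace T (evalHom S.carrier (prefixWord (w n) t'))) ≤
      L * (dist t t' * freeLength (w n) + 1) := by
    intro n t t'
    wlog htt : t ≤ t' generalizing t t'
    · rw [dist_comm, dist_comm t]
      exact this t' t (le_of_not_ge htt)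
    have h1 := hL ((evalHom S.carrier (prefixWord (w n) t))⁻¹ *
      evalHom S.carrier (prefixWord (w n) t'))
    have h2 := wordLength_le ((prefixWord (w n) t)⁻¹ * prefixWord (w n) t')
    rw [map_mul, map_inv] at h2
    have h3 := freeLength_prefixWord_inv_mul (w n) t.2.1 htt
    have h4 : dist t t' = (t' : ℝ) - t := by
      rw [dist_comm, Subtype.dist_eq, Real.dist_eq]
      exact abs_of_nonneg (sub_nonneg.mpr htt)
    have h5 : ((wordLength T.carrier ((evalHom S.carrier (prefixWord (w n) t))⁻¹ *
          evalHom S.carrier (prefixWord (w n) t')) : ℕ) : ℝ) ≤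
        L * freeLength ((prefixWord (w n) t)⁻¹ * prefixWord (w n) t') := by
      exact_mod_cast h1.trans (Nat.mul_le_mul_left L h2)
    rw [h4, dist_toWordSpace]
    exact h5.trans (mul_le_mul_of_nonneg_left h3 (Nat.cast_nonneg L))
  -- The set of good `n` does not depend on `t, t'`.
  have hd' : ∀ᶠ n in (ω : Filter ℕ), ∀ t t' : unitInterval,
      dist (toWordSpace T (evalHom S.carrier (prefixWord (w n) t)))
        (toWordSpace T (evalHom S.carrier (prefixWord (w n) t'))) / (s n : ℝ) ≤
      L * c * dist t t' + L * ((s n : ℝ))⁻¹ := by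
    filter_upwards [hw] with n hn t t'
    have hsn : (0 : ℝ) < s n := NNReal.coe_pos.mpr (hs.1 n)
    rw [div_le_iff₀ hsn]
    refine (hd n t t').trans ?_
    have e : (L * c * dist t t' + L * ((s n : ℝ))⁻¹) * (s n : ℝ) =
        L * (dist t t' * (c * s n) + 1) := by
      field_simp
    rw [e]
    gcongr
  have hinv : Tendsto (fun n => ((s n : ℝ))⁻¹) ω (𝓝 0) :=
    tendsto_inv_atTop_zero.comp (NNReal.tendsto_coe_atTop.mpr hs.2)
  have hlim : ∀ t t' : unitInterval, Tendsto (fun n => L * c * dist t t' + L * ((s n : ℝ))⁻¹) ω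
      (𝓝 (L * c * dist t t')) := by
    intro t t'
    simpa using tendsto_const_nhds.add (hinv.const_mul (L : ℝ))
  have hb : ∀ t : unitInterval, ∃ C : ℝ, ∀ᶠ n in (ω : Filter ℕ),
      dist (toWordSpace T (evalHom S.carrier (prefixWord (w n) t))) (oneSeq T n) / (s n : ℝ) ≤ C := by
    intro t
    refine ⟨L * c * dist t 0 + 1, ?_⟩
    filter_upwards [hd', (hlim t 0).eventually_le_const (lt_add_one _)] with n h1 h2
    have h3 := h1 t 0
    rw [Set.Icc.coe_zero, prefixWord_zero, map_one] at h3
    exact h3.trans h2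
  obtain ⟨u, hu⟩ : ∃ u : unitInterval → ConeSequence (oneSeq T) s ω, ∀ t n,
      (u t).1 n = toWordSpace T (evalHom S.carrier (prefixWord (w n) t)) :=
    ⟨fun t => ⟨_, hb t⟩, fun _ _ => rfl⟩
  refine ⟨u, hu, ?_⟩
  refine (LipschitzWith.of_dist_le_mul (K := (L * c).toNNReal) fun t t' => ?_).continuous
  rw [SeparationQuotient.dist_mk]
  refine le_trans (b := L * c * dist t t') ?_
    (mul_le_mul_of_nonneg_right (Real.le_coe_toNNReal _) dist_nonneg)
  exact le_of_tendsto_of_tendsto (tendsto_coneDist _ _) (hlim t t')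
    (hd'.mono fun n h => by beta_reduce; rw [hu, hu]; exact h t t')

/-- A null-homotopy of the limit loop, discretized and lifted to `G`, would fill some `w n` by
shorter relations. -/
theorem not_simplyConnectedSpace_of_relations (S T : CompactGenSet G) {s : ℕ → ℝ≥0}
    {ω : Ultrafilter ℕ} (hs : IsScaling s ω) {c : ℝ} (hc : 0 < c) (w : ℕ → FreeGroup S.carrier)
    (hker : ∀ n, w n ∈ (evalHom S.carrier).ker)
    (hw : ∀ᶠ n in (ω : Filter ℕ), (freeLength (w n) : ℝ) ≤ c * s n)
    (hw' : ∀ᶠ n in (ω : Filter ℕ), (s n : ℝ) ≤ c * freeLength (w n))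
    (hlong : ∀ᶠ n in (ω : Filter ℕ), w n ∉ shortRelations S.carrier (freeLength (w n))) :
    ¬ SimplyConnectedSpace (AsymptoticCone (oneSeq T) s ω) := by
  intro hsc
  obtain ⟨u, hu, hucont⟩ := exists_limit_loop S T hs w hw
  obtain ⟨L, hL⟩ := exists_wordLength_le_mul S T
  let base := baseSequence T s ω
  have hu0 : u 0 = base := Subtype.ext <| funext fun n => by
    rw [hu, Set.Icc.coe_zero, prefixWord_zero, map_one]
    rfl
  have hu1 : u 1 = base := Subtype.ext <| funext fun n => by
    rw [hu, Set.Icc.coe_one, prefixWord_one, MonoidHom.mem_ker.mp (hker n)]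
    rfl
  let γ : Path (SeparationQuotient.mk base : AsymptoticCone (oneSeq T) s ω) (SeparationQuotient.mk base) :=
    ⟨⟨_, hucont⟩, by simp [hu0], by simp [hu1]⟩
  obtain ⟨F⟩ := (simply_connected_iff_paths_homotopic'.mp hsc).2 γ (Path.refl _)
  -- Chosen so that `T`-distance below `ε s_n ≤ ε c r` forces `S`-length at most `L ε c r ≤ r / 8`;
  -- the `+ 1` covers `L = 0`.
  set ε : ℝ := 1 / (8 * L * c + 1) with hε
  have hεpos : 0 < ε := by positivity
  obtain ⟨η, hη, hF⟩ := Metric.uniformContinuous_iff.mp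
    (CompactSpace.uniformContinuous_of_continuous F.continuous) ε hεpos
  obtain ⟨K₀, hK₀⟩ := exists_nat_gt (1 / η)
  -- With `K ≥ 16` and `r ≥ 16`, a prefix step has length at most `r / K + 1 ≤ r / 8`.
  obtain ⟨K, hK16, hKK⟩ : ∃ K : ℕ, 16 ≤ K ∧ K₀ ≤ K := ⟨max 16 K₀, le_max_left _ _, le_max_right _ _⟩
  have hKpos : (0 : ℝ) < K := by
    have : 0 < K := by omega
    exact_mod_cast this
  have hKη : 1 / (K : ℝ) < η := by
    rw [div_lt_comm₀ hKpos hη]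
    exact hK₀.trans_le (by exact_mod_cast hKK)
  let q : ℕ → unitInterval := fun i => Set.projIcc 0 1 zero_le_one ((i : ℝ) / K)
  have hqc : ∀ i ≤ K, ((q i : unitInterval) : ℝ) = (i : ℝ) / K := by
    intro i hi
    have hi' : (i : ℝ) ≤ K := by exact_mod_cast hi
    exact congrArg Subtype.val (Set.projIcc_of_mem (h := zero_le_one (α := ℝ))
      ⟨by positivity, (div_le_one hKpos).mpr hi'⟩)
  have hq0 : q 0 = 0 := Subtype.ext (by rw [hqc 0 (Nat.zero_le _)]; simp)
  have hqK : q K = 1 := Subtype.ext (by rw [hqc K le_rfl, div_self hKpos.ne']; rfl)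
  have hqstep : ∀ i < K, ((q (i + 1) : unitInterval) : ℝ) - q i = 1 / K := by
    intro i hi
    rw [hqc i hi.le, hqc (i + 1) hi]
    push_cast
    ring
  have hqd : ∀ i < K, dist (q i) (q (i + 1)) < η := by
    intro i hi
    rw [dist_comm, Subtype.dist_eq, Real.dist_eq, hqstep i hi, abs_of_pos (by positivity)]
    exact hKη
  -- The index `j` follows the homotopy parameter. On the boundary the representatives are
  -- prescribed, since the grid lemma needs exact equalities in `G`, not equalities up to `o(s_n)`.
  have hex : ∀ i j : ℕ, ∃ v : ConeSequence (oneSeq T) s ω,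
      SeparationQuotient.mk v = F (q j, q i) ∧ (j = 0 → v = u (q i)) ∧
      (i = 0 ∨ i = K ∨ j = K → v = base) := by
    intro i j
    by_cases hb : i = 0 ∨ i = K ∨ j = K
    · refine ⟨base, ?_, ?_, fun _ => rfl⟩
      · rcases hb with rfl | rfl | rfl
        · rw [hq0, Path.Homotopy.source]
        · rw [hqK, Path.Homotopy.target]
        · rw [hqK, F.apply_one]; rfl
      · rintro rfl
        rcases hb with rfl | rfl | hb
        · rw [hq0, hu0]
        · rw [hqK, hu1]
        · omega
    · by_cases hj : j = 0
      · refine ⟨u (q i), ?_, fun _ => rfl, fun h => absurd h hb⟩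
        rw [hj, hq0, F.apply_zero]; rfl
      · obtain ⟨v, hv⟩ := SeparationQuotient.surjective_mk (F (q j, q i))
        exact ⟨v, hv, fun h => absurd h hj, fun h => absurd h hb⟩
  choose v hvF hv0 hvb using hex
  have hh : ∀ᶠ n in (ω : Filter ℕ), ∀ i ∈ Finset.range K, ∀ j ∈ Finset.range (K + 1),
      dist ((v i j).1 n) ((v (i + 1) j).1 n) < ε * s n := by
    rw [eventually_all_finset]
    intro i hi
    rw [eventually_all_finset]
    intro j _
    refine eventually_dist_lt_of_dist_mk_lt hs.1 ?_
    rw [hvF, hvF]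
    refine hF ?_
    rw [Prod.dist_eq, dist_self]
    exact max_lt hη (hqd i (Finset.mem_range.mp hi))
  have hv : ∀ᶠ n in (ω : Filter ℕ), ∀ i ∈ Finset.range (K + 1), ∀ j ∈ Finset.range K,
      dist ((v i j).1 n) ((v i (j + 1)).1 n) < ε * s n := by
    rw [eventually_all_finset]
    intro i _
    rw [eventually_all_finset]
    intro j hj
    refine eventually_dist_lt_of_dist_mk_lt hs.1 ?_
    rw [hvF, hvF]
    refine hF ?_
    rw [Prod.dist_eq, dist_self]
    exact max_lt (hqd j (Finset.mem_range.mp hj)) hη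
  have hbig : ∀ᶠ n in (ω : Filter ℕ), 16 * c ≤ (s n : ℝ) :=
    (NNReal.tendsto_coe_atTop.mpr hs.2).eventually_ge_atTop _
  -- Only finitely many grid inequalities are involved, so a single `n` satisfies them all.
  obtain ⟨n, hhn, hvn, hbn, hwn, hln⟩ := (hh.and (hv.and (hbig.and (hw'.and hlong)))).exists
  set r := freeLength (w n) with hr
  have hr16 : 16 ≤ r := by
    have h1 : c * 16 ≤ c * (r : ℝ) := by linarith
    exact_mod_cast le_of_mul_le_mul_left h1 hc
  have hshort : ∀ a b : G, dist (toWordSpace T a) (toWordSpace T b) < ε * s n →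
      wordLength S.carrier (a⁻¹ * b) ≤ r / 8 := by
    intro a b hab
    rw [Nat.le_div_iff_mul_le (by norm_num)]
    have h1 : (wordLength S.carrier (a⁻¹ * b) : ℝ) ≤
        L * dist (toWordSpace T a) (toWordSpace T b) := by
      rw [dist_toWordSpace]
      exact_mod_cast hL (a⁻¹ * b)
    have h2 : ε * (8 * L * c) ≤ 1 := by
      rw [hε, one_div_mul_eq_div, div_le_one (by positivity)]
      linarith
    have h3 : (wordLength S.carrier (a⁻¹ * b) : ℝ) * 8 ≤ r := by
      calc (wordLength S.carrier (a⁻¹ * b) : ℝ) * 8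
          ≤ L * (ε * (c * r)) * 8 := by
            have : dist (toWordSpace T a) (toWordSpace T b) ≤ ε * (c * r) := hab.le.trans (by gcongr)
            gcongr
            exact h1.trans (by gcongr)
        _ = ε * (8 * L * c) * r := by ring
        _ ≤ 1 * r := by gcongr
        _ = r := one_mul _
    exact_mod_cast h3
  refine hln ?_
  have hmem := mem_shortRelations_of_grid S.closure_eq_top (r := r) (δ := r / 8) (K := K)
    (by omega) (fun i j => (v i j).1 n) (fun i => prefixWord (w n) (q i))
    (by rw [hq0]; exact prefixWord_zero _)
    (fun i _ => by rw [hv0 i 0 rfl, hu]; rfl)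
    (fun i hi => by
      have hle : ((q i : unitInterval) : ℝ) ≤ q (i + 1) := by
        have h1 := hqstep i hi
        have h2 : 0 < 1 / (K : ℝ) := by positivity
        linarith
      have h1 := freeLength_prefixWord_inv_mul (w n) (q i).2.1 hle
      rw [hqstep i hi, ← hr] at h1
      rw [Nat.le_div_iff_mul_le (by norm_num)]
      have h2 : 1 / (K : ℝ) ≤ 1 / 16 := by
        have : (16 : ℝ) ≤ K := by exact_mod_cast hK16
        gcongr
      have h3 : 1 / (K : ℝ) * r ≤ 1 / 16 * r := by gcongr
      have h4 : (16 : ℝ) ≤ r := by exact_mod_cast hr16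
      have h5 : (freeLength ((prefixWord (w n) (q i))⁻¹ * prefixWord (w n) (q (i + 1))) : ℝ) * 8
          ≤ r := by linarith
      exact_mod_cast h5)
    (fun i hi j hj => hshort _ _
      (hhn i (Finset.mem_range.mpr hi) j (Finset.mem_range.mpr (by omega))))
    (fun i hi j hj => hshort _ _
      (hvn i (Finset.mem_range.mpr (by omega)) j (Finset.mem_range.mpr hj)))
    (fun j _ => by rw [hvb 0 j (Or.inl rfl)]; rfl)
    (fun j _ => by rw [hvb K j (Or.inr (Or.inl rfl))]; rfl)
    (fun i _ => by rw [hvb i K (Or.inr (Or.inr rfl))]; rfl)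
  rw [hqK] at hmem
  simpa only [Set.Icc.coe_one, prefixWord_one] using hmem

theorem not_simplyConnectedSpace_of_eventually (S T : CompactGenSet G) {s : ℕ → ℝ≥0}
    {ω : Ultrafilter ℕ} (hs : IsScaling s ω) {c : ℝ≥0} (hc : 0 < c)
    (h : ∀ᶠ n in (ω : Filter ℕ), ∃ b ∈ relationRangeNN S.carrier,
      c⁻¹ * s n ≤ b ∧ b ≤ c * s n) :
    ¬ SimplyConnectedSpace (GroupCone T s ω) := by
  have hex : ∀ n, ∃ w ∈ (evalHom S.carrier).ker,
      (∃ b ∈ relationRangeNN S.carrier, c⁻¹ * s n ≤ b ∧ b ≤ c * s n) →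
        (freeLength w : ℝ≥0) ≤ c * s n ∧ s n ≤ c * freeLength w ∧
        w ∉ shortRelations S.carrier (freeLength w) := by
    intro n
    by_cases hn : ∃ b ∈ relationRangeNN S.carrier, c⁻¹ * s n ≤ b ∧ b ≤ c * s n
    · obtain ⟨_, ⟨r, hr, rfl⟩, h1, h2⟩ := hn
      obtain ⟨w, hwk, hwr, hw⟩ := exists_relation_of_mem_relationRange hr
      subst hwr
      exact ⟨w, hwk, fun _ => ⟨h2, (inv_mul_le_iff₀ hc).mp h1, hw⟩⟩
    · exact ⟨1, one_mem _, fun h => absurd h hn⟩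
  choose w hwk hw using hex
  refine not_simplyConnectedSpace_of_relations S T hs (c := c) (NNReal.coe_pos.mpr hc) w hwk
    ?_ ?_ ?_
  · filter_upwards [h] with n hn
    exact_mod_cast (hw n hn).1
  · filter_upwards [h] with n hn
    exact_mod_cast (hw n hn).2.1
  · filter_upwards [h] with n hn
    exact (hw n hn).2.2

end Loop

/-! ### Comparison of subsets of `[0, ∞)` and the main theorem -/

theorem Dominated.trans {A B C : Set ℝ≥0} (hAB : Dominated A B) (hBC : Dominated B C) :
    Dominated A C := by
  obtain ⟨c, hc, h⟩ := hAB
  obtain ⟨d, hd, h'⟩ := hBC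
  refine ⟨d * c, mul_pos hd hc, fun a ha => ?_⟩
  obtain ⟨b, hb, h1, h2⟩ := h a ha
  obtain ⟨e, he, h3, h4⟩ := h' b hb
  refine ⟨e, he, le_trans ?_ h3, h4.trans ?_⟩
  · rw [mul_inv, mul_assoc]
    gcongr
  · rw [mul_assoc]
    gcongr

theorem Dominated.of_subset {A B : Set ℝ≥0} (h : A ⊆ B) : Dominated A B :=
  ⟨1, one_pos, fun a ha => ⟨a, h ha, by simp⟩⟩

theorem ClassSubset.dominated {A B : Set ℝ≥0} (h : ClassSubset A B) : Dominated A B := by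
  obtain ⟨A', B', hA, hB, hAB⟩ := h
  exact (hA.2.trans (Dominated.of_subset hAB)).trans hB.1

theorem DenselyRelated.not_simplyConnectedSpace {G : Type*} [Group G] [TopologicalSpace G]
    [IsTopologicalGroup G] [LocallyCompactSpace G] [T2Space G] (hG : DenselyRelated G)
    (T : CompactGenSet G) {s : ℕ → ℝ≥0} {ω : Ultrafilter ℕ} (hs : IsScaling s ω) :
    ¬ SimplyConnectedSpace (GroupCone T s ω) := by
  obtain ⟨S, -, hS⟩ := hG
  have hdom : Dominated (Set.Ici 1) positiveIntegers := by
    -- For `a ≥ 1`, `a ≤ ⌈a⌉ ≤ a + 1 ≤ 2a`.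
    refine ⟨2, two_pos, fun a ha => ⟨(⌈a⌉₊ : ℝ≥0), ⟨⌈a⌉₊, ?_, rfl⟩, ?_, ?_⟩⟩
    · exact Nat.one_le_ceil_iff.mpr (one_pos.trans_le ha)
    · refine le_trans ?_ (Nat.le_ceil a)
      exact mul_le_of_le_one_left (zero_le) (by norm_num)
    · refine (Nat.ceil_lt_add_one (zero_le)).le.trans ?_
      rw [two_mul]
      exact add_le_add_right (Set.mem_Ici.mp ha) a
  obtain ⟨c, hc, h⟩ := hdom.trans hS
  exact not_simplyConnectedSpace_of_eventually S T hs hc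
    ((hs.2.eventually_ge_atTop 1).mono fun n hn => h (s n) hn)

end RelRange

theorem mainTheorem2 {G : Type*} [Group G] [TopologicalSpace G] [IsTopologicalGroup G]
    [LocallyCompactSpace G] [T2Space G] :
    (∀ (S T : RelRange.CompactGenSet G) (s : ℕ → ℝ≥0) (ω : Ultrafilter ℕ),
      RelRange.IsScaling s ω →
      SimplyConnectedSpace (RelRange.GroupCone T s ω) →
      ¬ RelRange.ClassSubset (Set.range s) (RelRange.relationRangeNN S.carrier)) ∧
    (RelRange.DenselyRelated G →
      ∀ (T : RelRange.CompactGenSet G) (s : ℕ → ℝ≥0) (ω : Ultrafilter ℕ),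
        RelRange.IsScaling s ω → ¬ SimplyConnectedSpace (RelRange.GroupCone T s ω)) ∧
    (RelRange.LacunaryHyperbolic G → RelRange.LacunaryPresented G) := by
  refine ⟨fun S T s ω hs hsc hsub => ?_, fun hG T s ω hs => hG.not_simplyConnectedSpace T hs, ?_⟩
  · obtain ⟨c, hc, h⟩ := hsub.dominated
    exact RelRange.not_simplyConnectedSpace_of_eventually S T hs hc
      (Eventually.of_forall fun n => h (s n) ⟨n, rfl⟩) hsc
  · rintro ⟨S, s, ω, hs, htree⟩
    refine ⟨⟨S⟩, fun hG => hG.not_simplyConnectedSpace S hs ?_⟩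
    have : Nonempty (RelRange.GroupCone S s ω) :=
      ⟨(SeparationQuotient.mk (RelRange.baseSequence S s ω) :
        RelRange.AsymptoticCone (RelRange.oneSeq S) s ω)⟩
    have := htree.contractibleSpace
    infer_instance
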